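/- Let $n\ge 3$, let $M$ be a smooth $n$-dimensional manifold with a smooth Riemannian metric $g=(g_{ij})$, and let $F$ be a smooth function on $M$ such that $(M,g,F)$ is a gradient steady Ricci soliton, i.e. $R_{ij}=\nabla_i\nabla_jF$, where $\nabla$ is the Levi-Civita connection of $g$ and $R_{ik}=g^{jl}R_{ijkl}$ is its Ricci tensor; the sign of the Riemann tensor $R_{ijkl}$ is such that $R_{ijij}>0$ ($i\ne j$, orthonormal frame) on round spheres. (The metric is not required to be complete.) Let $R=g^{ij}R_{ij}$ be the scalar curvature and $G=|\nabla F|^2$. Suppose that the Weyl tensor $$W_{ijkl}=R_{ijkl}-\frac{1}{n-2}\left(g_{ik}R_{jl}-g_{il}R_{jk}-g_{jk}R_{il}+g_{jl}R_{ik}\right)+\frac{R}{(n-1)(n-2)}\left(g_{ik}g_{jl}-g_{il}g_{jk}\right)$$ vanishes identically on $M$. Then the Cotton tensor $$C_{ijk}=\nabla_kR_{ij}-\nabla_jR_{ik}-\frac{1}{2(n-1)}\left(g_{ij}\nabla_kR-g_{ik}\nabla_jR\right)$$ satisfies, at every point of $M$, $$|C_{ijk}|^2=\frac{1}{(n-2)^2}\left(\left|R_{ik}\nabla_jF-R_{ij}\nabla_kF\right|^2-\frac{2}{n-1}\left|R\,\nabla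 F-\tfrac12\nabla G\right|^2\right),$$ where the squared norm of a tensor is its full contraction with itself by $g$, e.g. $|T_{ijk}|^2=g^{ia}g^{jb}g^{kc}T_{ijk}T_{abc}$. -/

import Mathlib

open scoped Manifold ContDiff

noncomputable section

/-- The model space `ℝⁿ`; points are written in coordinates `(y⁰, …, yⁿ⁻¹)`. -/
abbrev RSpace (n : ℕ) : Type := EuclideanSpace ℝ (Fin n)

/-! ## Tensor calculus in a coordinate domain

Here `g : RSpace n → Matrix (Fin n) (Fin n) ℝ` is the matrix `g_{ij}` of a metric in local
coordinates; `(g y)⁻¹ i j` is then `g^{ij}`. All tensors are given by their covariant components,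
as functions of the point `y`. -/

namespace LocalTensor

/-- The partial derivative `∂ᵢ u` at `y`. -/
def pd {n : ℕ} (i : Fin n) (u : RSpace n → ℝ) (y : RSpace n) : ℝ :=
  fderiv ℝ u y (EuclideanSpace.single i 1)

/-- Christoffel symbols of the Levi-Civita connection:
`Γ^k_{ij} = ½ g^{kl} (∂ᵢ g_{jl} + ∂ⱼ g_{il} - ∂ₗ g_{ij})`. -/
def christoffel {n : ℕ} (g : RSpace n → Matrix (Fin n) (Fin n) ℝ) (k i j : Fin n)
    (y : RSpace n) : ℝ :=
  (1 / 2) * ∑ l, (g y)⁻¹ k l *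
    (pd i (fun z => g z j l) y + pd j (fun z => g z i l) y - pd l (fun z => g z i j) y)

/-- The components `A^l_{ijk}` of the curvature operator of the Levi-Civita connection,
`∇ᵢ ∇ⱼ ∂ₖ - ∇ⱼ ∇ᵢ ∂ₖ = A^l_{ijk} ∂ₗ`. -/
def curvOp {n : ℕ} (g : RSpace n → Matrix (Fin n) (Fin n) ℝ) (l i j k : Fin n)
    (y : RSpace n) : ℝ :=
  pd i (christoffel g l j k) y - pd j (christoffel g l i k) y
    + ∑ m, (christoffel g l i m y * christoffel g m j k y
        - christoffel g l j m y * christoffel g m i k y)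

/-- The Riemann tensor `R_{ijkl} = ⟨(∇ᵢ ∇ⱼ - ∇ⱼ ∇ᵢ) ∂ₗ, ∂ₖ⟩`, with the sign for which
`R_{ijij} > 0` (for `i ≠ j`) on round spheres. -/
def riem {n : ℕ} (g : RSpace n → Matrix (Fin n) (Fin n) ℝ) (i j k l : Fin n)
    (y : RSpace n) : ℝ :=
  ∑ m, g y k m * curvOp g m i j l y

/-- The Ricci tensor `R_{ik} = g^{jl} R_{ijkl}` (positive on round spheres). -/
def ricci {n : ℕ} (g : RSpace n → Matrix (Fin n) (Fin n) ℝ) (i k : Fin n)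
    (y : RSpace n) : ℝ :=
  ∑ j, ∑ l, (g y)⁻¹ j l * riem g i j k l y

/-- The scalar curvature `R = g^{ij} R_{ij}`. -/
def scal {n : ℕ} (g : RSpace n → Matrix (Fin n) (Fin n) ℝ) (y : RSpace n) : ℝ :=
  ∑ i, ∑ j, (g y)⁻¹ i j * ricci g i j y

/-- The covariant derivative `∇ₖ T_{ij} = ∂ₖ T_{ij} - Γ^m_{ki} T_{mj} - Γ^m_{kj} T_{im}` of a
covariant 2-tensor. -/
def covDeriv {n : ℕ} (g : RSpace n → Matrix (Fin n) (Fin n) ℝ)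
    (T : Fin n → Fin n → RSpace n → ℝ) (k i j : Fin n) (y : RSpace n) : ℝ :=
  pd k (T i j) y - ∑ m, christoffel g m k i y * T m j y - ∑ m, christoffel g m k j y * T i m y

/-- The Hessian `∇ᵢ ∇ⱼ f = ∂ᵢ ∂ⱼ f - Γ^k_{ij} ∂ₖ f`. -/
def hess {n : ℕ} (g : RSpace n → Matrix (Fin n) (Fin n) ℝ) (f : RSpace n → ℝ) (i j : Fin n)
    (y : RSpace n) : ℝ :=
  pd i (pd j f) y - ∑ k, christoffel g k i j y * pd k f y

/-- The Weyl tensor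
`W_{ijkl} = R_{ijkl} - (g_{ik} R_{jl} - g_{il} R_{jk} - g_{jk} R_{il} + g_{jl} R_{ik}) / (n - 2)
  + R (g_{ik} g_{jl} - g_{il} g_{jk}) / ((n - 1) (n - 2))`. -/
def weyl {n : ℕ} (g : RSpace n → Matrix (Fin n) (Fin n) ℝ) (i j k l : Fin n)
    (y : RSpace n) : ℝ :=
  riem g i j k l y
    - 1 / ((n : ℝ) - 2) * (g y i k * ricci g j l y - g y i l * ricci g j k y
        - g y j k * ricci g i l y + g y j l * ricci g i k y)
    + scal g y / (((n : ℝ) - 1) * ((n : ℝ) - 2)) * (g y i k * g y j l - g y i l * g y j k)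

/-- The Cotton tensor
`C_{ijk} = ∇ₖ R_{ij} - ∇ⱼ R_{ik} - (g_{ij} ∇ₖ R - g_{ik} ∇ⱼ R) / (2 (n - 1))`. -/
def cotton {n : ℕ} (g : RSpace n → Matrix (Fin n) (Fin n) ℝ) (i j k : Fin n)
    (y : RSpace n) : ℝ :=
  covDeriv g (ricci g) k i j y - covDeriv g (ricci g) j i k y
    - 1 / (2 * ((n : ℝ) - 1)) * (g y i j * pd k (scal g) y - g y i k * pd j (scal g) y)

/-- The squared norm `|v|² = g^{ij} vᵢ vⱼ` of a covector (equivalently of the vector dual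
to it under the metric). -/
def normSq₁ {n : ℕ} (g : RSpace n → Matrix (Fin n) (Fin n) ℝ) (v : Fin n → ℝ)
    (y : RSpace n) : ℝ :=
  ∑ i, ∑ j, (g y)⁻¹ i j * v i * v j

/-- The squared norm `|T|² = g^{ia} g^{jb} g^{kc} T_{ijk} T_{abc}` of a covariant 3-tensor. -/
def normSq₃ {n : ℕ} (g : RSpace n → Matrix (Fin n) (Fin n) ℝ) (T : Fin n → Fin n → Fin n → ℝ)
    (y : RSpace n) : ℝ :=
  ∑ i, ∑ j, ∑ k, ∑ a, ∑ b, ∑ c,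
    (g y)⁻¹ i a * (g y)⁻¹ j b * (g y)⁻¹ k c * T i j k * T a b c

/-- The function `G = |∇ f|²`. -/
def gradSq {n : ℕ} (g : RSpace n → Matrix (Fin n) (Fin n) ℝ) (f : RSpace n → ℝ)
    (y : RSpace n) : ℝ :=
  normSq₁ g (fun i => pd i f y) y

end LocalTensor

/-! ## Riemannian manifolds in charts -/

/-- A smooth Riemannian metric on the smooth `n`-manifold `M`. -/
abbrev SmoothMetric (n : ℕ) (M : Type*) [TopologicalSpace M] [ChartedSpace (RSpace n) M]
    [IsManifold (𝓡 n) ∞ M] :=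
  Bundle.ContMDiffRiemannianMetric (𝓡 n) ∞ (RSpace n) (fun x : M => TangentSpace (𝓡 n) x)

/-- The coordinate vector field `∂ᵢ` of the chart `e`, as a tangent vector to `M` at the point
with coordinates `y`. -/
def coordVec {n : ℕ} {M : Type*} [TopologicalSpace M] [ChartedSpace (RSpace n) M]
    (e : OpenPartialHomeomorph M (RSpace n)) (i : Fin n) (y : RSpace n) :
    TangentSpace (𝓡 n) (e.symm y) :=
  mfderiv (𝓡 n) (𝓡 n) e.symm y
    (show TangentSpace (𝓡 n) y from (EuclideanSpace.single i 1 : RSpace n))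

/-- The components `g_{ij} = g(∂ᵢ, ∂ⱼ)` of the metric in the chart `e`, as functions of the
coordinates. -/
def metricCoord {n : ℕ} {M : Type*} [TopologicalSpace M] [ChartedSpace (RSpace n) M]
    [IsManifold (𝓡 n) ∞ M] (g : SmoothMetric n M) (e : OpenPartialHomeomorph M (RSpace n))
    (y : RSpace n) : Matrix (Fin n) (Fin n) ℝ :=
  Matrix.of fun i j => g.inner (e.symm y) (coordVec e i y) (coordVec e j y)

/-- `(M, g, F)` is a gradient steady Ricci soliton with potential function `F`: `F` is smooth and
`R_{ij} = ∇ᵢ ∇ⱼ F` in all local coordinates. -/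
structure IsGradientSteadySoliton {n : ℕ} {M : Type*} [TopologicalSpace M]
    [ChartedSpace (RSpace n) M] [IsManifold (𝓡 n) ∞ M] (g : SmoothMetric n M) (F : M → ℝ) :
    Prop where
  smooth : ContMDiff (𝓡 n) 𝓘(ℝ, ℝ) ∞ F
  ricci_eq_hess : ∀ e ∈ IsManifold.maximalAtlas (𝓡 n) ∞ M, ∀ p ∈ e.source, ∀ i j : Fin n,
    LocalTensor.ricci (metricCoord g e) i j (e p)
      = LocalTensor.hess (metricCoord g e) (F ∘ e.symm) i j (e p)

/-- The Weyl tensor of `g` vanishes: `W_{ijkl} = 0` in all local coordinates. -/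
def HasVanishingWeyl {n : ℕ} {M : Type*} [TopologicalSpace M] [ChartedSpace (RSpace n) M]
    [IsManifold (𝓡 n) ∞ M] (g : SmoothMetric n M) : Prop :=
  ∀ e ∈ IsManifold.maximalAtlas (𝓡 n) ∞ M, ∀ p ∈ e.source, ∀ i j k l : Fin n,
    LocalTensor.weyl (metricCoord g e) i j k l (e p) = 0

end

noncomputable section

namespace LocalTensor

/-! ### Calculus of partial derivatives -/

/-! The claim is local, so it is proved for a smooth nondegenerate symmetric matrix function on an
open subset of `ℝⁿ` and then applied to the metric in a chart. Differentiating `Ric = ∇²F` and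
skew-symmetrising gives, by the Ricci identity, `∇ₖR_{ij} - ∇ⱼR_{ik} = R_{kjil} ∇^l F`
(`covDeriv_ricci_sub`). Its trace, together with the contracted Bianchi identity
(`contracted_bianchi`) and `Ric(∇F) = ½∇G` (`pd_gradSq`), yields `∇R = -∇G` (`pd_scal_of_soliton`).
Where `W = 0`, the curvature on the right is expressed by `g`, `Ric` and `R`, so the Cotton tensor
becomes algebraic in `Ric`, `R`, `∇F`, `∇G`: it is `1/(n-2)` times the trace-free part of `T_{ijk} =
R_{ik}∇ⱼF - R_{ij}∇ₖF`, whose trace is `V = R∇F - ½∇G` (`cotton_eq`). Removing that trace lowers the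
squared norm by `2|V|²/(n-1)` (`normSq₃_traceFree`). The connection and curvature are handled as
matrices, so that the skew-adjointness of the curvature and the second Bianchi identity reduce to
noncommutative ring identities. -/

theorem contDiffAt_of_mem {n : ℕ} {U : Set (RSpace n)} (hU : IsOpen U) {u : RSpace n → ℝ}
    (hu : ContDiffOn ℝ ∞ u U) {y : RSpace n} (hy : y ∈ U) : ContDiffAt ℝ ∞ u y :=
  hu.contDiffAt (hU.mem_nhds hy)

theorem differentiableAt_of_mem {n : ℕ} {U : Set (RSpace n)} (hU : IsOpen U) {u : RSpace n → ℝ}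
    (hu : ContDiffOn ℝ ∞ u U) {y : RSpace n} (hy : y ∈ U) : DifferentiableAt ℝ u y :=
  (contDiffAt_of_mem hU hu hy).differentiableAt (by simp)

theorem pd_congr {n : ℕ} {U : Set (RSpace n)} (hU : IsOpen U) {u v : RSpace n → ℝ}
    (h : ∀ y ∈ U, u y = v y) {y : RSpace n} (hy : y ∈ U) (i : Fin n) : pd i u y = pd i v y := by
  have : u =ᶠ[nhds y] v := Filter.eventually_of_mem (hU.mem_nhds hy) h
  simp only [pd, this.fderiv_eq]

theorem pd_add {n : ℕ} {u v : RSpace n → ℝ} {y : RSpace n} (hu : DifferentiableAt ℝ u y)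
    (hv : DifferentiableAt ℝ v y) (i : Fin n) :
    pd i (fun z => u z + v z) y = pd i u y + pd i v y := by
  simp [pd, fderiv_fun_add hu hv]

theorem pd_sub {n : ℕ} {u v : RSpace n → ℝ} {y : RSpace n} (hu : DifferentiableAt ℝ u y)
    (hv : DifferentiableAt ℝ v y) (i : Fin n) :
    pd i (fun z => u z - v z) y = pd i u y - pd i v y := by
  simp [pd, fderiv_fun_sub hu hv]

theorem pd_mul {n : ℕ} {u v : RSpace n → ℝ} {y : RSpace n} (hu : DifferentiableAt ℝ u y)
    (hv : DifferentiableAt ℝ v y) (i : Fin n) :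
    pd i (fun z => u z * v z) y = pd i u y * v y + u y * pd i v y := by
  simp [pd, fderiv_fun_mul hu hv]; ring

theorem pd_sum {n : ℕ} {ι : Type*} [Fintype ι] {u : ι → RSpace n → ℝ} {y : RSpace n}
    (hu : ∀ a, DifferentiableAt ℝ (u a) y) (i : Fin n) :
    pd i (fun z => ∑ a, u a z) y = ∑ a, pd i (u a) y := by
  simp [pd, fderiv_fun_sum (fun a _ => hu a)]

theorem pd_const {n : ℕ} (c : ℝ) (y : RSpace n) (i : Fin n) :
    pd i (fun _ => c) y = 0 := by
  simp [pd]

theorem contDiffOn_pd {n : ℕ} {U : Set (RSpace n)} (hU : IsOpen U) {u : RSpace n → ℝ}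
    (hu : ContDiffOn ℝ ∞ u U) (i : Fin n) : ContDiffOn ℝ ∞ (pd i u) U :=
  (hu.fderiv_of_isOpen hU (by simp)).clm_apply contDiffOn_const

theorem pd_comm {n : ℕ} {U : Set (RSpace n)} (hU : IsOpen U) {u : RSpace n → ℝ}
    (hu : ContDiffOn ℝ ∞ u U) {y : RSpace n} (hy : y ∈ U) (i j : Fin n) :
    pd i (pd j u) y = pd j (pd i u) y := by
  have hs : IsSymmSndFDerivAt ℝ u y :=
    (contDiffAt_of_mem hU hu hy).isSymmSndFDerivAt (by
      simpa using WithTop.coe_le_coe.2 (le_top : (2 : ℕ∞) ≤ ⊤))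
  have hd : DifferentiableAt ℝ (fderiv ℝ u) y :=
    ((hu.fderiv_of_isOpen hU (m := ∞) (by simp)).contDiffAt (hU.mem_nhds hy)).differentiableAt
      (by simp)
  have key : ∀ a b : Fin n, pd a (pd b u) y
      = fderiv ℝ (fderiv ℝ u) y (EuclideanSpace.single a 1) (EuclideanSpace.single b 1) := by
    intro a b
    change fderiv ℝ (fun z => fderiv ℝ u z (EuclideanSpace.single b 1)) y _ = _
    rw [fderiv_clm_apply hd (differentiableAt_const _)]
    simp
  rw [key, key, hs.eq]

/-! ### Matrix-valued functions -/

/-- The entrywise partial derivative of a matrix-valued function. -/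
def pdMat {n : ℕ} (i : Fin n) (A : RSpace n → Matrix (Fin n) (Fin n) ℝ) (y : RSpace n) :
    Matrix (Fin n) (Fin n) ℝ :=
  Matrix.of fun a b => pd i (fun z => A z a b) y

/-- Entrywise smoothness of a matrix-valued function. -/
def SmoothMat {n : ℕ} (U : Set (RSpace n)) (A : RSpace n → Matrix (Fin n) (Fin n) ℝ) : Prop :=
  ∀ a b, ContDiffOn ℝ ∞ (fun z => A z a b) U

section Mat

variable {n : ℕ} {U : Set (RSpace n)} {A B : RSpace n → Matrix (Fin n) (Fin n) ℝ} {y : RSpace n}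

theorem SmoothMat.mul (hA : SmoothMat U A) (hB : SmoothMat U B) :
    SmoothMat U (fun z => A z * B z) := by
  intro a b
  simp only [Matrix.mul_apply]
  exact ContDiffOn.sum fun c _ => (hA a c).mul (hB c b)

theorem SmoothMat.add (hA : SmoothMat U A) (hB : SmoothMat U B) :
    SmoothMat U (fun z => A z + B z) := fun a b => (hA a b).add (hB a b)

theorem SmoothMat.sub (hA : SmoothMat U A) (hB : SmoothMat U B) :
    SmoothMat U (fun z => A z - B z) := fun a b => (hA a b).sub (hB a b)

theorem SmoothMat.transpose (hA : SmoothMat U A) :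
    SmoothMat U (fun z => (A z).transpose) := fun a b => hA b a

theorem SmoothMat.pdMat (hU : IsOpen U) (hA : SmoothMat U A) (i : Fin n) :
    SmoothMat U (pdMat i A) := fun a b => contDiffOn_pd hU (hA a b) i

/-- Cramer's rule: each entry of the inverse is a quotient of determinants, which are polynomials in
the entries. -/
theorem SmoothMat.inv (hA : SmoothMat U A) (hdet : ∀ z ∈ U, (A z).det ≠ 0) :
    SmoothMat U (fun z => (A z)⁻¹) := by
  have hd : ∀ B : RSpace n → Matrix (Fin n) (Fin n) ℝ, SmoothMat U B →
      ContDiffOn ℝ ∞ (fun z => (B z).det) U := by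
    intro B hB
    simp only [Matrix.det_apply']
    exact ContDiffOn.sum fun σ _ => contDiffOn_const.mul (contDiffOn_prod fun i _ => hB _ _)
  intro a b
  simp only [Matrix.inv_def, Ring.inverse_eq_inv', Matrix.smul_apply, smul_eq_mul,
    Matrix.adjugate_apply]
  refine ((hd A hA).inv hdet).mul (hd _ fun c d => ?_)
  simp only [Matrix.updateRow_apply]
  split_ifs
  · exact contDiffOn_const
  · exact hA c d

theorem pdMat_mul (hU : IsOpen U) (hA : SmoothMat U A) (hB : SmoothMat U B) (hy : y ∈ U)
    (i : Fin n) :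
    pdMat i (fun z => A z * B z) y = pdMat i A y * B y + A y * pdMat i B y := by
  have dA := fun a b => differentiableAt_of_mem hU (hA a b) hy
  have dB := fun a b => differentiableAt_of_mem hU (hB a b) hy
  ext a b
  simp only [pdMat, Matrix.mul_apply, Matrix.of_apply, Matrix.add_apply]
  rw [pd_sum fun c => (dA a c).fun_mul (dB c b), ← Finset.sum_add_distrib]
  exact Finset.sum_congr rfl fun c _ => pd_mul (dA a c) (dB c b) i

theorem pdMat_add (hU : IsOpen U) (hA : SmoothMat U A) (hB : SmoothMat U B) (hy : y ∈ U)
    (i : Fin n) : pdMat i (fun z => A z + B z) y = pdMat i A y + pdMat i B y := by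
  ext a b
  exact pd_add (differentiableAt_of_mem hU (hA a b) hy) (differentiableAt_of_mem hU (hB a b) hy) i

theorem pdMat_sub (hU : IsOpen U) (hA : SmoothMat U A) (hB : SmoothMat U B) (hy : y ∈ U)
    (i : Fin n) : pdMat i (fun z => A z - B z) y = pdMat i A y - pdMat i B y := by
  ext a b
  exact pd_sub (differentiableAt_of_mem hU (hA a b) hy) (differentiableAt_of_mem hU (hB a b) hy) i

theorem pdMat_transpose (i : Fin n) :
    pdMat i (fun z => (A z).transpose) y = (pdMat i A y).transpose := rfl

theorem pdMat_comm (hU : IsOpen U) (hA : SmoothMat U A) (hy : y ∈ U) (i j : Fin n) :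
    pdMat i (pdMat j A) y = pdMat j (pdMat i A) y := by
  ext a b
  exact pd_comm hU (hA a b) hy i j

theorem pdMat_congr (hU : IsOpen U) (h : ∀ z ∈ U, A z = B z) (hy : y ∈ U) (i : Fin n) :
    pdMat i A y = pdMat i B y := by
  ext a b
  exact pd_congr hU (fun z hz => by rw [h z hz]) hy i

end Mat

/-! ### The Levi-Civita connection and its curvature -/

/-- `g` is a smooth nondegenerate symmetric matrix-valued function on the open set `U`. -/
structure IsMetricOn {n : ℕ} (U : Set (RSpace n)) (g : RSpace n → Matrix (Fin n) (Fin n) ℝ) :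
    Prop where
  isOpen : IsOpen U
  smooth : SmoothMat U g
  symm : ∀ y i j, g y i j = g y j i
  det_ne_zero : ∀ y ∈ U, (g y).det ≠ 0

/-- The connection matrices `(Γᵢ)^k_j = Γ^k_{ij}`. -/
def connMat {n : ℕ} (g : RSpace n → Matrix (Fin n) (Fin n) ℝ) (i : Fin n) (y : RSpace n) :
    Matrix (Fin n) (Fin n) ℝ :=
  Matrix.of fun k j => christoffel g k i j y

/-- The curvature matrices `(Aᵢⱼ)^l_k = A^l_{ijk}`. -/
def curvMat {n : ℕ} (g : RSpace n → Matrix (Fin n) (Fin n) ℝ) (i j : Fin n) (y : RSpace n) :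
    Matrix (Fin n) (Fin n) ℝ :=
  Matrix.of fun l k => curvOp g l i j k y

/-- Cartan's structure equation `A = dΓ + Γ ∧ Γ`, which removes indices from the curvature
identities below. -/
theorem curvMat_eq {n : ℕ} (g : RSpace n → Matrix (Fin n) (Fin n) ℝ) (i j : Fin n)
    (y : RSpace n) :
    curvMat g i j y = pdMat i (connMat g j) y - pdMat j (connMat g i) y
      + (connMat g i y * connMat g j y - connMat g j y * connMat g i y) := by
  ext l k
  simp [curvMat, curvOp, pdMat, connMat, Matrix.mul_apply]

section Metric

variable {n : ℕ} {U : Set (RSpace n)} {g : RSpace n → Matrix (Fin n) (Fin n) ℝ} {y : RSpace n}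

theorem IsMetricOn.smooth_inv (hg : IsMetricOn U g) : SmoothMat U (fun z => (g z)⁻¹) :=
  hg.smooth.inv hg.det_ne_zero

theorem IsMetricOn.inv_mul (hg : IsMetricOn U g) (hy : y ∈ U) : (g y)⁻¹ * g y = 1 :=
  Matrix.nonsing_inv_mul _ (isUnit_iff_ne_zero.2 (hg.det_ne_zero y hy))

theorem IsMetricOn.mul_inv (hg : IsMetricOn U g) (hy : y ∈ U) : g y * (g y)⁻¹ = 1 :=
  Matrix.mul_nonsing_inv _ (isUnit_iff_ne_zero.2 (hg.det_ne_zero y hy))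

theorem IsMetricOn.transpose_eq (hg : IsMetricOn U g) (y : RSpace n) :
    (g y).transpose = g y := by
  ext i j; exact hg.symm y j i

theorem IsMetricOn.inv_symm (hg : IsMetricOn U g) (y : RSpace n) (i j : Fin n) :
    (g y)⁻¹ i j = (g y)⁻¹ j i := by
  have h : ((g y)⁻¹).transpose = (g y)⁻¹ := by
    rw [Matrix.transpose_nonsing_inv, hg.transpose_eq]
  exact congrFun (congrFun h j) i

theorem IsMetricOn.christoffel_symm (hg : IsMetricOn U g) (k i j : Fin n) (y : RSpace n) :
    christoffel g k i j y = christoffel g k j i y := by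
  have h : (fun z => g z i j) = fun z => g z j i := funext fun z => hg.symm z i j
  simp only [christoffel, h]
  congr 1
  exact Finset.sum_congr rfl fun l _ => by ring

theorem IsMetricOn.smooth_christoffel (hg : IsMetricOn U g) (k i j : Fin n) :
    ContDiffOn ℝ ∞ (christoffel g k i j) U := by
  have hp := fun i a b => contDiffOn_pd hg.isOpen (hg.smooth a b) i
  exact contDiffOn_const.mul (ContDiffOn.sum fun l _ =>
    (hg.smooth_inv k l).mul (((hp i j l).add (hp j i l)).sub (hp l i j)))

theorem IsMetricOn.smooth_connMat (hg : IsMetricOn U g) (i : Fin n) : SmoothMat U (connMat g i) :=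
  fun k j => hg.smooth_christoffel k i j

theorem IsMetricOn.smooth_curvOp (hg : IsMetricOn U g) (l i j k : Fin n) :
    ContDiffOn ℝ ∞ (curvOp g l i j k) U := by
  have h := hg.smooth_christoffel
  exact ((contDiffOn_pd hg.isOpen (h l j k) i).sub (contDiffOn_pd hg.isOpen (h l i k) j)).add
    (ContDiffOn.sum fun m _ => ((h l i m).mul (h m j k)).sub ((h l j m).mul (h m i k)))

theorem IsMetricOn.smooth_riem (hg : IsMetricOn U g) (i j k l : Fin n) :
    ContDiffOn ℝ ∞ (riem g i j k l) U :=
  ContDiffOn.sum fun m _ => (hg.smooth k m).mul (hg.smooth_curvOp m i j l)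

theorem IsMetricOn.smooth_ricci (hg : IsMetricOn U g) (i k : Fin n) :
    ContDiffOn ℝ ∞ (ricci g i k) U :=
  ContDiffOn.sum fun j _ => ContDiffOn.sum fun l _ =>
    (hg.smooth_inv j l).mul (hg.smooth_riem i j k l)

/-- The Christoffel symbols of the first kind. -/
theorem IsMetricOn.sum_mul_christoffel (hg : IsMetricOn U g) (hy : y ∈ U) (i j k : Fin n) :
    ∑ m, g y k m * christoffel g m i j y = (1 / 2) *
      (pd i (fun z => g z j k) y + pd j (fun z => g z i k) y - pd k (fun z => g z i j) y) := by
  let v : Fin n → ℝ := fun l =>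
    pd i (fun z => g z j l) y + pd j (fun z => g z i l) y - pd l (fun z => g z i j) y
  have h : (g y).mulVec ((g y)⁻¹.mulVec v) = v := by
    rw [Matrix.mulVec_mulVec, hg.mul_inv hy, Matrix.one_mulVec]
  have hk : ∑ m, g y k m * ∑ l, (g y)⁻¹ m l * v l = v k := congrFun h k
  change _ = (1 / 2) * v k
  rw [← hk, Finset.mul_sum]
  exact Finset.sum_congr rfl fun m _ => mul_left_comm _ _ _

/-- Metric compatibility of the Levi-Civita connection. -/
theorem IsMetricOn.pdMat_metric (hg : IsMetricOn U g) (hy : y ∈ U) (i : Fin n) :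
    pdMat i g y = g y * connMat g i y + (connMat g i y).transpose * g y := by
  ext a b
  have h1 := hg.sum_mul_christoffel hy i b a
  have h2 := hg.sum_mul_christoffel hy i a b
  have hs : ∀ a b : Fin n, (fun z => g z a b) = fun z => g z b a :=
    fun a b => funext fun z => hg.symm z a b
  simp only [pdMat, Matrix.add_apply, Matrix.mul_apply, connMat, Matrix.of_apply,
    Matrix.transpose_apply]
  have h3 : ∑ m, christoffel g m i a y * g y m b = ∑ m, g y b m * christoffel g m i a y :=
    Finset.sum_congr rfl fun m _ => by rw [hg.symm y m b]; ring
  rw [h3, h1, h2, hs b a, hs i a, hs i b]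
  ring

/-- Differentiate `g g⁻¹ = 1` and use metric compatibility; this says that `g⁻¹` is parallel. -/
theorem IsMetricOn.pdMat_inv (hg : IsMetricOn U g) (hy : y ∈ U) (i : Fin n) :
    pdMat i (fun z => (g z)⁻¹) y
      = -((g y)⁻¹ * (connMat g i y).transpose + connMat g i y * (g y)⁻¹) := by
  have h0 : pdMat i (fun z => g z * (g z)⁻¹) y = 0 := by
    rw [pdMat_congr hg.isOpen (B := fun _ => 1) (fun z hz => hg.mul_inv hz) hy]
    ext a b
    exact pd_const _ _ _
  rw [pdMat_mul hg.isOpen hg.smooth hg.smooth_inv hy, hg.pdMat_metric hy] at h0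
  have h1 := congrArg (fun M => (g y)⁻¹ * M) h0
  simp only [Matrix.mul_add, Matrix.add_mul, ← Matrix.mul_assoc, hg.inv_mul hy,
    Matrix.one_mul, Matrix.mul_zero] at h1
  rw [Matrix.mul_assoc _ (g y), hg.mul_inv hy, Matrix.mul_one] at h1
  rw [eq_neg_iff_add_eq_zero, ← h1]
  abel

/-- Skew-adjointness of the curvature operator. -/
theorem IsMetricOn.curvMat_skew (hg : IsMetricOn U g) (hy : y ∈ U) (i j : Fin n) :
    g y * curvMat g i j y + (curvMat g i j y).transpose * g y = 0 := by
  have hU := hg.isOpen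
  have hΓ := hg.smooth_connMat
  have second : ∀ a b, pdMat a (pdMat b g) y
      = (g y * connMat g a y + (connMat g a y).transpose * g y) * connMat g b y
        + g y * pdMat a (connMat g b) y
        + ((pdMat a (connMat g b) y).transpose * g y
          + (connMat g b y).transpose
            * (g y * connMat g a y + (connMat g a y).transpose * g y)) := by
    intro a b
    rw [pdMat_congr hU (fun z hz => hg.pdMat_metric hz b) hy,
      pdMat_add hU (hg.smooth.mul (hΓ b)) ((hΓ b).transpose.mul hg.smooth) hy,
      pdMat_mul hU hg.smooth (hΓ b) hy, pdMat_mul hU (hΓ b).transpose hg.smooth hy,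
      hg.pdMat_metric hy, pdMat_transpose]
  -- Expanding `∂ᵢ∂ⱼg = ∂ⱼ∂ᵢg` by metric compatibility, all terms cancel except those forming the
  -- curvature.
  have h := pdMat_comm hU hg.smooth hy i j
  rw [second, second] at h
  rw [curvMat_eq]
  simp only [Matrix.transpose_add, Matrix.transpose_sub, Matrix.transpose_mul]
  rw [← sub_eq_zero] at h
  rw [← h]
  noncomm_ring

/-- The second Bianchi identity, in matrix form. -/
theorem IsMetricOn.bianchi_mat (hg : IsMetricOn U g) (hy : y ∈ U) (m i j : Fin n) :
    (pdMat m (curvMat g i j) y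
        + (connMat g m y * curvMat g i j y - curvMat g i j y * connMat g m y))
      + (pdMat i (curvMat g j m) y
        + (connMat g i y * curvMat g j m y - curvMat g j m y * connMat g i y))
      + (pdMat j (curvMat g m i) y
        + (connMat g j y * curvMat g m i y - curvMat g m i y * connMat g j y)) = 0 := by
  have hU := hg.isOpen
  have hΓ := hg.smooth_connMat
  have hd : ∀ c a b, pdMat c (curvMat g a b) y
      = pdMat c (pdMat a (connMat g b)) y - pdMat c (pdMat b (connMat g a)) y
        + ((pdMat c (connMat g a) y * connMat g b y + connMat g a y * pdMat c (connMat g b) y)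
          - (pdMat c (connMat g b) y * connMat g a y
            + connMat g b y * pdMat c (connMat g a) y)) := by
    intro c a b
    rw [pdMat_congr hU (fun z _ => curvMat_eq g a b z) hy,
      pdMat_add hU (((hΓ b).pdMat hU a).sub ((hΓ a).pdMat hU b))
        (((hΓ a).mul (hΓ b)).sub ((hΓ b).mul (hΓ a))) hy,
      pdMat_sub hU ((hΓ b).pdMat hU a) ((hΓ a).pdMat hU b) hy,
      pdMat_sub hU ((hΓ a).mul (hΓ b)) ((hΓ b).mul (hΓ a)) hy,
      pdMat_mul hU (hΓ a) (hΓ b) hy, pdMat_mul hU (hΓ b) (hΓ a) hy]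
  rw [hd, hd, hd, pdMat_comm hU (hΓ j) hy m i, pdMat_comm hU (hΓ i) hy m j,
    pdMat_comm hU (hΓ m) hy i j]
  simp only [curvMat_eq]
  noncomm_ring

end Metric

theorem curvOp_swap {n : ℕ} (g : RSpace n → Matrix (Fin n) (Fin n) ℝ) (l i j k : Fin n)
    (y : RSpace n) : curvOp g l i j k y = -curvOp g l j i k y := by
  simp only [curvOp, Finset.sum_sub_distrib]
  ring

theorem riem_swap {n : ℕ} (g : RSpace n → Matrix (Fin n) (Fin n) ℝ) (i j k l : Fin n)
    (y : RSpace n) : riem g i j k l y = -riem g j i k l y := by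
  simp only [riem, curvOp_swap g _ i j, mul_neg, Finset.sum_neg_distrib]

/-- The covariant derivative `∇ₘ A^l_{ijk}` of the curvature operator. -/
def covDerivCurvOp {n : ℕ} (g : RSpace n → Matrix (Fin n) (Fin n) ℝ) (m l i j k : Fin n)
    (y : RSpace n) : ℝ :=
  pd m (curvOp g l i j k) y + ∑ s, christoffel g l m s y * curvOp g s i j k y
    - ∑ s, christoffel g s m i y * curvOp g l s j k y
    - ∑ s, christoffel g s m j y * curvOp g l i s k y
    - ∑ s, christoffel g s m k y * curvOp g l i j s y

/-! ### Second Bianchi identity in components and its contractions -/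

section Metric

variable {n : ℕ} {U : Set (RSpace n)} {g : RSpace n → Matrix (Fin n) (Fin n) ℝ} {y : RSpace n}

theorem IsMetricOn.sum_inv_mul_mul (hg : IsMetricOn U g) (hy : y ∈ U) (v : Fin n → ℝ)
    (i : Fin n) : ∑ j, (g y)⁻¹ i j * ∑ k, g y j k * v k = v i := by
  have h : (g y)⁻¹.mulVec ((g y).mulVec v) = v := by
    rw [Matrix.mulVec_mulVec, hg.inv_mul hy, Matrix.one_mulVec]
  exact congrFun h i

theorem IsMetricOn.sum_mul_inv_mul (hg : IsMetricOn U g) (hy : y ∈ U) (v : Fin n → ℝ)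
    (i : Fin n) : ∑ j, g y i j * ∑ k, (g y)⁻¹ j k * v k = v i := by
  have h : (g y).mulVec ((g y)⁻¹.mulVec v) = v := by
    rw [Matrix.mulVec_mulVec, hg.mul_inv hy, Matrix.one_mulVec]
  exact congrFun h i

theorem IsMetricOn.pd_inv (hg : IsMetricOn U g) (hy : y ∈ U) (m j k : Fin n) :
    pd m (fun z => (g z)⁻¹ j k) y
      = -(∑ s, christoffel g j m s y * (g y)⁻¹ s k + ∑ s, christoffel g k m s y * (g y)⁻¹ j s) := by
  have h := congrFun (congrFun (hg.pdMat_inv hy m) j) k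
  simp only [pdMat, Matrix.of_apply, Matrix.neg_apply, Matrix.add_apply, Matrix.mul_apply,
    Matrix.transpose_apply, connMat] at h
  rw [h, add_comm]
  simp only [mul_comm]

theorem IsMetricOn.riem_skew (hg : IsMetricOn U g) (hy : y ∈ U) (i j k l : Fin n) :
    riem g i j k l y = -riem g i j l k y := by
  have h := congrFun (congrFun (hg.curvMat_skew hy i j) k) l
  simp only [Matrix.add_apply, Matrix.mul_apply, Matrix.transpose_apply, curvMat,
    Matrix.of_apply, Matrix.zero_apply] at h
  rw [eq_neg_iff_add_eq_zero, ← h]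
  simp only [riem]
  congr 1
  exact Finset.sum_congr rfl fun m _ => by rw [hg.symm y l m, mul_comm]

/-- The second Bianchi identity. -/
theorem IsMetricOn.bianchi (hg : IsMetricOn U g) (hy : y ∈ U) (m l i j k : Fin n) :
    covDerivCurvOp g m l i j k y + covDerivCurvOp g i l j m k y
      + covDerivCurvOp g j l m i k y = 0 := by
  have h := congrFun (congrFun (hg.bianchi_mat hy m i j) l) k
  simp only [pdMat, Matrix.add_apply, Matrix.sub_apply, Matrix.mul_apply, curvMat, connMat,
    Matrix.of_apply, Matrix.zero_apply] at h
  -- `P` collects the Christoffel terms acting on the two form indices. Absence of torsion makes it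
  -- symmetric in `a`, `b`, so these terms cancel in the cyclic sum and the matrix identity remains.
  let P : Fin n → Fin n → Fin n → ℝ := fun a b c =>
    ∑ s, christoffel g s a b y * curvOp g l s c k y
  have hP : ∀ a b c, P a b c = P b a c := fun a b c =>
    Finset.sum_congr rfl fun s _ => by rw [hg.christoffel_symm s a b]
  have hD : ∀ a b c, covDerivCurvOp g a l b c k y = pd a (curvOp g l b c k) y
      + (∑ s, christoffel g l a s y * curvOp g s b c k y
        - ∑ s, curvOp g l b c s y * christoffel g s a k y) - P a b c + P a c b := by
    intro a b c
    have h1 : ∑ s, christoffel g s a c y * curvOp g l b s k y = -P a c b := by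
      simp only [P, curvOp_swap g l b, mul_neg, Finset.sum_neg_distrib]
    have h2 : ∑ s, christoffel g s a k y * curvOp g l b c s y
        = ∑ s, curvOp g l b c s y * christoffel g s a k y :=
      Finset.sum_congr rfl fun s _ => mul_comm _ _
    simp only [covDerivCurvOp, h1, h2, P]
    ring
  rw [← h, hD, hD, hD, hP i m, hP j i, hP j m]
  ring

/-- Flipping both skew pairs gives `R_{ijkl} = R_{jilk}`, which puts `l` in the slot lowered by `g`.
Pair symmetry of the Riemann tensor is not needed. -/
theorem IsMetricOn.ricci_eq_trace (hg : IsMetricOn U g) (hy : y ∈ U) (i k : Fin n) :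
    ricci g i k y = ∑ j, curvOp g j j i k y := by
  simp only [ricci]
  refine Finset.sum_congr rfl fun j _ => ?_
  rw [← hg.sum_inv_mul_mul hy (fun m => curvOp g m j i k y) j]
  refine Finset.sum_congr rfl fun l _ => ?_
  rw [hg.riem_skew hy, riem_swap, neg_neg, riem]

theorem IsMetricOn.sum_inv_mul_ricci (hg : IsMetricOn U g) (hy : y ∈ U) (i l : Fin n) :
    ∑ k, (g y)⁻¹ l k * ricci g i k y = ∑ j, ∑ k, (g y)⁻¹ j k * curvOp g l i j k y := by
  have : ∀ k, ricci g i k y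
      = ∑ m, g y k m * ∑ a, ∑ b, (g y)⁻¹ a b * curvOp g m i a b y := by
    intro k
    simp only [ricci, riem, Finset.mul_sum]
    calc _ = ∑ a, ∑ m, ∑ b, (g y)⁻¹ a b * (g y k m * curvOp g m i a b y) :=
          Finset.sum_congr rfl fun _ _ => Finset.sum_comm
      _ = ∑ m, ∑ a, ∑ b, (g y)⁻¹ a b * (g y k m * curvOp g m i a b y) := Finset.sum_comm
      _ = _ := by simp only [mul_left_comm]
  simp only [this]
  exact hg.sum_inv_mul_mul hy _ l

/-- The Christoffel terms of the contracted upper and lower index cancel after exchanging `l` and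
`s`. -/
theorem IsMetricOn.trace_covDerivCurvOp (hg : IsMetricOn U g) (hy : y ∈ U) (i j k : Fin n) :
    ∑ l, covDerivCurvOp g i l l j k y = covDeriv g (ricci g) i j k y := by
  have h : pd i (ricci g j k) y = ∑ l, pd i (curvOp g l l j k) y := by
    rw [pd_congr hg.isOpen (fun z hz => hg.ricci_eq_trace hz j k) hy,
      pd_sum fun l => differentiableAt_of_mem hg.isOpen (hg.smooth_curvOp l l j k) hy]
  have c1 : ∑ l, ∑ s, christoffel g l i s y * curvOp g s l j k y
      = ∑ l, ∑ s, christoffel g s i l y * curvOp g l s j k y := Finset.sum_comm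
  have c2 : ∑ l, ∑ s, christoffel g s i j y * curvOp g l l s k y
      = ∑ s, christoffel g s i j y * ∑ l, curvOp g l l s k y := by
    rw [Finset.sum_comm]; simp only [Finset.mul_sum]
  have c3 : ∑ l, ∑ s, christoffel g s i k y * curvOp g l l j s y
      = ∑ s, christoffel g s i k y * ∑ l, curvOp g l l j s y := by
    rw [Finset.sum_comm]; simp only [Finset.mul_sum]
  simp only [covDerivCurvOp, covDeriv, Finset.sum_sub_distrib, Finset.sum_add_distrib, h,
    hg.ricci_eq_trace hy, c1, c2, c3]
  ring

/-- Covariant differentiation commutes with the contraction of two indices by the metric. -/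
theorem IsMetricOn.pd_contract (hg : IsMetricOn U g) (hy : y ∈ U)
    {T : Fin n → Fin n → RSpace n → ℝ} (hT : ∀ j k, ContDiffOn ℝ ∞ (T j k) U) (m : Fin n) :
    pd m (fun z => ∑ j, ∑ k, (g z)⁻¹ j k * T j k z) y
      = ∑ j, ∑ k, (g y)⁻¹ j k * covDeriv g T m j k y := by
  have dI := fun j k => differentiableAt_of_mem hg.isOpen (hg.smooth_inv j k) hy
  have dT := fun j k => differentiableAt_of_mem hg.isOpen (hT j k) hy
  rw [pd_sum fun j => DifferentiableAt.fun_sum fun k _ => (dI j k).fun_mul (dT j k)]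
  have e1 : ∀ j, pd m (fun z => ∑ k, (g z)⁻¹ j k * T j k z) y
      = ∑ k, (pd m (fun z => (g z)⁻¹ j k) y * T j k y + (g y)⁻¹ j k * pd m (T j k) y) := by
    intro j
    rw [pd_sum fun k => (dI j k).fun_mul (dT j k)]
    exact Finset.sum_congr rfl fun k _ => pd_mul (dI j k) (dT j k) m
  simp only [e1, hg.pd_inv hy, covDeriv, mul_sub, neg_mul, add_mul, Finset.sum_add_distrib,
    Finset.sum_sub_distrib, Finset.sum_neg_distrib]
  have c1 : ∑ j, ∑ k, (∑ s, christoffel g j m s y * (g y)⁻¹ s k) * T j k y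
      = ∑ j, ∑ k, (g y)⁻¹ j k * ∑ s, christoffel g s m j y * T s k y := by
    simp only [Finset.mul_sum, Finset.sum_mul]
    calc _ = ∑ j, ∑ s, ∑ k, christoffel g j m s y * (g y)⁻¹ s k * T j k y :=
          Finset.sum_congr rfl fun _ _ => Finset.sum_comm
      _ = ∑ s, ∑ j, ∑ k, christoffel g j m s y * (g y)⁻¹ s k * T j k y := Finset.sum_comm
      _ = ∑ s, ∑ k, ∑ j, christoffel g j m s y * (g y)⁻¹ s k * T j k y :=
          Finset.sum_congr rfl fun _ _ => Finset.sum_comm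
      _ = _ := by simp only [mul_assoc, mul_left_comm]
  have c2 : ∑ j, ∑ k, (∑ s, christoffel g k m s y * (g y)⁻¹ j s) * T j k y
      = ∑ j, ∑ k, (g y)⁻¹ j k * ∑ s, christoffel g s m k y * T j s y := by
    simp only [Finset.mul_sum, Finset.sum_mul]
    refine Finset.sum_congr rfl fun j _ => ?_
    rw [Finset.sum_comm]
    simp only [mul_assoc, mul_left_comm]
  rw [c1, c2]
  ring

theorem IsMetricOn.pd_scal (hg : IsMetricOn U g) (hy : y ∈ U) (m : Fin n) :
    pd m (scal g) y = ∑ j, ∑ k, (g y)⁻¹ j k * covDeriv g (ricci g) m j k y :=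
  hg.pd_contract hy hg.smooth_ricci m

/-- Contraction of the covariant derivative of the curvature operator in its last two indices. -/
theorem IsMetricOn.contract_covDerivCurvOp (hg : IsMetricOn U g) (hy : y ∈ U) (m l i : Fin n) :
    ∑ j, ∑ k, (g y)⁻¹ j k * covDerivCurvOp g m l i j k y
      = ∑ k, (g y)⁻¹ l k * covDeriv g (ricci g) m i k y := by
  have dI := fun j k => differentiableAt_of_mem hg.isOpen (hg.smooth_inv j k) hy
  have dR := fun k => differentiableAt_of_mem hg.isOpen (hg.smooth_ricci i k) hy
  -- `B` is the mixed Ricci tensor, written both as a contracted curvature and as `g⁻¹ Ric`.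
  -- Differentiating the two forms produces the same Christoffel corrections, so the covariant
  -- derivatives agree.
  let B : Fin n → Fin n → RSpace n → ℝ := fun l i z =>
    ∑ j, ∑ k, (g z)⁻¹ j k * curvOp g l i j k z
  have hB : ∀ l i, ∀ z ∈ U, B l i z = ∑ k, (g z)⁻¹ l k * ricci g i k z :=
    fun l i z hz => (hg.sum_inv_mul_ricci hz i l).symm
  have left : pd m (B l i) y = ∑ j, ∑ k, (g y)⁻¹ j k * covDerivCurvOp g m l i j k y
      - ∑ s, christoffel g l m s y * B s i y + ∑ s, christoffel g s m i y * B l s y := by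
    have e : pd m (B l i) y
        = ∑ j, ∑ k, (g y)⁻¹ j k * covDeriv g (fun j k => curvOp g l i j k) m j k y :=
      hg.pd_contract hy (fun j k => hg.smooth_curvOp l i j k) m
    have swap : ∀ f : Fin n → Fin n → Fin n → ℝ,
        ∑ s, ∑ j, ∑ k, f s j k = ∑ j, ∑ k, ∑ s, f s j k := fun f => by
      rw [Finset.sum_comm]
      exact Finset.sum_congr rfl fun _ _ => Finset.sum_comm
    have e1 : ∑ s, christoffel g l m s y * B s i y
        = ∑ j, ∑ k, (g y)⁻¹ j k * ∑ s, christoffel g l m s y * curvOp g s i j k y := by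
      simp only [B, Finset.mul_sum, mul_left_comm ((g y)⁻¹ _ _)]
      exact swap _
    have e2 : ∑ s, christoffel g s m i y * B l s y
        = ∑ j, ∑ k, (g y)⁻¹ j k * ∑ s, christoffel g s m i y * curvOp g l s j k y := by
      simp only [B, Finset.mul_sum, mul_left_comm ((g y)⁻¹ _ _)]
      exact swap _
    rw [e, e1, e2]
    simp only [← Finset.sum_add_distrib, ← Finset.sum_sub_distrib]
    refine Finset.sum_congr rfl fun j _ => Finset.sum_congr rfl fun k _ => ?_
    simp only [covDeriv, covDerivCurvOp]
    ring
  have right : pd m (B l i) y = ∑ k, (g y)⁻¹ l k * covDeriv g (ricci g) m i k y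
      - ∑ s, christoffel g l m s y * B s i y + ∑ s, christoffel g s m i y * B l s y := by
    rw [pd_congr hg.isOpen (hB l i) hy, pd_sum fun k => (dI l k).fun_mul (dR k)]
    simp only [pd_mul (dI l _) (dR _), hg.pd_inv hy, hB _ _ y hy, covDeriv]
    have c1 : ∑ k, (∑ s, christoffel g l m s y * (g y)⁻¹ s k) * ricci g i k y
        = ∑ s, christoffel g l m s y * ∑ k, (g y)⁻¹ s k * ricci g i k y := by
      simp only [Finset.mul_sum, Finset.sum_mul]
      rw [Finset.sum_comm]
      simp only [mul_assoc]
    have c2 : ∑ k, (∑ s, christoffel g k m s y * (g y)⁻¹ l s) * ricci g i k y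
        = ∑ k, (g y)⁻¹ l k * ∑ s, christoffel g s m k y * ricci g i s y := by
      simp only [Finset.mul_sum, Finset.sum_mul]
      rw [Finset.sum_comm]
      simp only [mul_assoc, mul_left_comm]
    have c3 : ∑ s, christoffel g s m i y * ∑ k, (g y)⁻¹ l k * ricci g s k y
        = ∑ k, (g y)⁻¹ l k * ∑ s, christoffel g s m i y * ricci g s k y := by
      simp only [Finset.mul_sum]
      rw [Finset.sum_comm]
      simp only [mul_left_comm]
    simp only [mul_sub, neg_mul, add_mul, Finset.sum_add_distrib, Finset.sum_sub_distrib,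
      Finset.sum_neg_distrib, c1, c2, c3]
    ring
  linarith

theorem covDerivCurvOp_swap (m l i j k : Fin n) :
    covDerivCurvOp g m l i j k y = -covDerivCurvOp g m l j i k y := by
  have h : curvOp g l i j k = fun z => -1 * curvOp g l j i k z :=
    funext fun z => by rw [curvOp_swap g l i j]; ring
  have hp : pd m (curvOp g l i j k) y = -pd m (curvOp g l j i k) y := by
    rw [h]
    simp [pd, fderiv_fun_neg]
  simp only [covDerivCurvOp, hp, curvOp_swap g _ i, curvOp_swap g l _ j,
    mul_neg, Finset.sum_neg_distrib]
  ring

/-- The contracted second Bianchi identity `∇^k R_{ik} = ½ ∇ᵢ R`. -/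
theorem IsMetricOn.contracted_bianchi (hg : IsMetricOn U g) (hy : y ∈ U) (i : Fin n) :
    2 * ∑ j, ∑ k, (g y)⁻¹ j k * covDeriv g (ricci g) j i k y = pd i (scal g) y := by
  -- Trace the second Bianchi identity over `m = l` and over `j`, `k` by `g⁻¹`: two of its terms
  -- become the divergence of Ricci, the third becomes `-∇R`.
  have h1 : ∑ l, ∑ j, ∑ k, (g y)⁻¹ j k * covDerivCurvOp g l l i j k y
      = ∑ j, ∑ k, (g y)⁻¹ j k * covDeriv g (ricci g) j i k y :=
    Finset.sum_congr rfl fun l _ => hg.contract_covDerivCurvOp hy l l i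
  have swap : ∀ f : Fin n → Fin n → Fin n → ℝ,
      ∑ s, ∑ j, ∑ k, f s j k = ∑ j, ∑ k, ∑ s, f s j k := fun f => by
    rw [Finset.sum_comm]
    exact Finset.sum_congr rfl fun _ _ => Finset.sum_comm
  have h2 : ∑ l, ∑ j, ∑ k, (g y)⁻¹ j k * covDerivCurvOp g i l j l k y
      = -pd i (scal g) y := by
    have h : ∀ l j k, covDerivCurvOp g i l j l k y = -covDerivCurvOp g i l l j k y :=
      fun l j k => covDerivCurvOp_swap i l j l k
    rw [swap, hg.pd_scal hy]
    simp only [h, ← Finset.mul_sum, Finset.sum_neg_distrib, mul_neg,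
      hg.trace_covDerivCurvOp hy]
  have h3 : ∑ l, ∑ j, ∑ k, (g y)⁻¹ j k * covDerivCurvOp g j l l i k y
      = ∑ j, ∑ k, (g y)⁻¹ j k * covDeriv g (ricci g) j i k y := by
    rw [swap]
    simp only [← Finset.mul_sum, hg.trace_covDerivCurvOp hy]
  have h0 : ∑ l, ∑ j, ∑ k, (g y)⁻¹ j k * (covDerivCurvOp g l l i j k y
      + covDerivCurvOp g i l j l k y + covDerivCurvOp g j l l i k y) = 0 := by
    simp [hg.bianchi hy]
  simp only [mul_add, Finset.sum_add_distrib, h1, h2, h3] at h0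
  linarith

end Metric
end LocalTensor

/-! ### The metric in a chart: smoothness and nondegeneracy -/

open Bundle in
theorem contMDiffOn_coordVec {n : ℕ} {M : Type*} [TopologicalSpace M]
    [ChartedSpace (RSpace n) M] [IsManifold (𝓡 n) ∞ M]
    {e : OpenPartialHomeomorph M (RSpace n)} (he : e ∈ IsManifold.maximalAtlas (𝓡 n) ∞ M)
    (i : Fin n) :
    ContMDiffOn (𝓡 n) ((𝓡 n).prod (𝓡 n)) ∞
      (fun y => TotalSpace.mk' (RSpace n) (E := fun x : M => TangentSpace (𝓡 n) x)
        (e.symm y) (coordVec e i y)) e.target := by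
  have hs : ContMDiffOn (𝓡 n) (𝓡 n) ∞ e.symm e.target :=
    contMDiffOn_symm_of_mem_maximalAtlas he
  -- The coordinate field is the tangent map of `e.symm` applied to a constant section, hence
  -- smooth.
  have ht := hs.contMDiffOn_tangentMapWithin (m := ∞) (by simp) e.open_target.uniqueMDiffOn
  have hv : ContMDiffOn (𝓡 n) ((𝓡 n).prod (𝓡 n)) ∞
      (fun y : RSpace n => TotalSpace.mk' (RSpace n)
        (E := fun x : RSpace n => TangentSpace (𝓡 n) x) y
        (EuclideanSpace.single i 1 : RSpace n)) e.target := by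
    intro y _
    exact contMDiffWithinAt_vectorSpace_iff_contDiffWithinAt.2 contDiffWithinAt_const
  refine (ht.comp hv fun y hy => hy).congr fun y hy => ?_
  simp only [Function.comp, tangentMapWithin, coordVec]
  rw [mfderivWithin_of_isOpen e.open_target hy]

theorem contDiffOn_metricCoord {n : ℕ} {M : Type*} [TopologicalSpace M]
    [ChartedSpace (RSpace n) M] [IsManifold (𝓡 n) ∞ M] (g : SmoothMetric n M)
    {e : OpenPartialHomeomorph M (RSpace n)} (he : e ∈ IsManifold.maximalAtlas (𝓡 n) ∞ M)
    (i j : Fin n) : ContDiffOn ℝ ∞ (fun y => metricCoord g e y i j) e.target := by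
  rw [← contMDiffOn_iff_contDiffOn]
  intro y hy
  have h := ((g.contMDiff.comp_contMDiffOn (contMDiffOn_symm_of_mem_maximalAtlas he))
    y hy).clm_bundle_apply₂ (F₁ := RSpace n) (F₂ := RSpace n) (F₃ := ℝ)
    (E₃ := Bundle.Trivial M ℝ)
    (contMDiffOn_coordVec he i y hy) (contMDiffOn_coordVec he j y hy)
  simp only [Bundle.contMDiffWithinAt_totalSpace] at h
  exact h.2

theorem linearIndependent_coordVec {n : ℕ} {M : Type*} [TopologicalSpace M]
    [ChartedSpace (RSpace n) M] [IsManifold (𝓡 n) ∞ M]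
    {e : OpenPartialHomeomorph M (RSpace n)} (he : e ∈ IsManifold.maximalAtlas (𝓡 n) ∞ M)
    {y : RSpace n} (hy : y ∈ e.target) : LinearIndependent ℝ (fun i => coordVec e i y) := by
  have hd : e.MDifferentiable (𝓡 n) (𝓡 n) := by
    exact ⟨(contMDiffOn_of_mem_maximalAtlas he).mdifferentiableOn (by simp),
      (contMDiffOn_symm_of_mem_maximalAtlas he).mdifferentiableOn (by simp)⟩
  have hinj := (hd.symm.mfderiv_injective (x := y) hy)
  have hb : LinearIndependent ℝ fun i : Fin n => (EuclideanSpace.single i (1 : ℝ)) := by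
    have h : LinearIndependent ℝ (EuclideanSpace.basisFun (Fin n) ℝ) :=
      (EuclideanSpace.basisFun (Fin n) ℝ).orthonormal.linearIndependent
    convert h with i
    simp
  exact hb.map' (mfderiv (𝓡 n) (𝓡 n) e.symm y).toLinearMap (LinearMap.ker_eq_bot.2 hinj)

theorem det_metricCoord_ne_zero {n : ℕ} {M : Type*} [TopologicalSpace M]
    [ChartedSpace (RSpace n) M] [IsManifold (𝓡 n) ∞ M] (g : SmoothMetric n M)
    {e : OpenPartialHomeomorph M (RSpace n)} (he : e ∈ IsManifold.maximalAtlas (𝓡 n) ∞ M)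
    {y : RSpace n} (hy : y ∈ e.target) : (metricCoord g e y).det ≠ 0 := by
  intro h
  obtain ⟨v, hv, hv0⟩ := Matrix.exists_mulVec_eq_zero_iff.2 h
  -- A kernel vector `v` of the Gram matrix gives a tangent vector of length zero, which positivity
  -- forces to vanish.
  have h1 : g.inner (e.symm y) (∑ i, v i • coordVec e i y) (∑ i, v i • coordVec e i y)
      = ∑ i, v i * (metricCoord g e y).mulVec v i := by
    simp only [map_sum, map_smul, sum_apply, smul_apply,
      Matrix.mulVec, dotProduct, metricCoord, Matrix.of_apply, smul_eq_mul, Finset.mul_sum]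
    rw [Finset.sum_comm]
    exact Finset.sum_congr rfl fun i _ => Finset.sum_congr rfl fun j _ => by ring
  have h2 : ∑ i, v i • coordVec e i y = 0 := by
    by_contra h3
    have := g.pos _ _ h3
    rw [h1, hv0] at this
    simp at this
  exact hv (funext (Fintype.linearIndependent_iff.1 (linearIndependent_coordVec he hy) v h2))

theorem isMetricOn_metricCoord {n : ℕ} {M : Type*} [TopologicalSpace M]
    [ChartedSpace (RSpace n) M] [IsManifold (𝓡 n) ∞ M] (g : SmoothMetric n M)
    {e : OpenPartialHomeomorph M (RSpace n)} (he : e ∈ IsManifold.maximalAtlas (𝓡 n) ∞ M) :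
    LocalTensor.IsMetricOn e.target (metricCoord g e) where
  isOpen := e.open_target
  smooth := contDiffOn_metricCoord g he
  symm _ _ _ := g.symm _ _ _
  det_ne_zero _ hy := det_metricCoord_ne_zero g he hy

namespace LocalTensor

/-! ### Differential identities on a steady soliton -/

section Soliton

variable {n : ℕ} {U : Set (RSpace n)} {g : RSpace n → Matrix (Fin n) (Fin n) ℝ}
  {f : RSpace n → ℝ} {y : RSpace n}

theorem covDeriv_congr (hU : IsOpen U) {S T : Fin n → Fin n → RSpace n → ℝ}
    (h : ∀ z ∈ U, ∀ i j, S i j z = T i j z) (hy : y ∈ U) (k i j : Fin n) :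
    covDeriv g S k i j y = covDeriv g T k i j y := by
  simp only [covDeriv, h y hy, pd_congr hU (fun z hz => h z hz i j) hy]

theorem covDeriv_symm (hU : IsOpen U) {T : Fin n → Fin n → RSpace n → ℝ}
    (h : ∀ z ∈ U, ∀ i j, T i j z = T j i z) (hy : y ∈ U) (k i j : Fin n) :
    covDeriv g T k i j y = covDeriv g T k j i y := by
  simp only [covDeriv, h y hy i, h y hy _ j, pd_congr hU (fun z hz => h z hz i j) hy]
  ring

theorem IsMetricOn.hess_symm (hg : IsMetricOn U g) (hf : ContDiffOn ℝ ∞ f U) (hy : y ∈ U)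
    (i j : Fin n) : hess g f i j y = hess g f j i y := by
  simp only [hess, pd_comm hg.isOpen hf hy i j, hg.christoffel_symm _ i j]

/-- The Ricci identity for the differential of a function. -/
theorem IsMetricOn.covDeriv_hess_sub (hg : IsMetricOn U g) (hf : ContDiffOn ℝ ∞ f U)
    (hy : y ∈ U) (k i j : Fin n) :
    covDeriv g (hess g f) k i j y - covDeriv g (hess g f) j i k y
      = -∑ l, curvOp g l k j i y * pd l f y := by
  have hU := hg.isOpen
  have hf1 := contDiffOn_pd hU hf
  have d1 := fun a => differentiableAt_of_mem hU (hf1 a) hy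
  have d2 := fun a b => differentiableAt_of_mem hU (contDiffOn_pd hU (hf1 a) b) hy
  have dΓ := fun a b c => differentiableAt_of_mem hU (hg.smooth_christoffel a b c) hy
  have hd : ∀ k i j, pd k (hess g f i j) y = pd k (pd i (pd j f)) y
      - (∑ s, pd k (christoffel g s i j) y * pd s f y
        + ∑ s, christoffel g s i j y * pd k (pd s f) y) := by
    intro k i j
    change pd k (fun z => pd i (pd j f) z - ∑ s, christoffel g s i j z * pd s f z) y = _
    rw [pd_sub (d2 j i) (DifferentiableAt.fun_sum fun s _ => (dΓ s i j).fun_mul (d1 s)),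
      pd_sum fun s => (dΓ s i j).fun_mul (d1 s), ← Finset.sum_add_distrib]
    congr 1
    exact Finset.sum_congr rfl fun s _ => pd_mul (dΓ s i j) (d1 s) k
  -- Third derivatives of `f` drop out of the commutator; `e5` does the same for the second
  -- derivatives, leaving only the curvature acting on `df`.
  have h3 : pd k (pd i (pd j f)) y = pd j (pd i (pd k f)) y := by
    rw [pd_comm hU (hf1 j) hy k i, pd_congr hU (fun z hz => pd_comm hU hf hz k j) hy,
      pd_comm hU (hf1 k) hy i j]
  have hq : ∀ a b c : Fin n, ∑ m, christoffel g m a b y * ∑ s, christoffel g s m c y * pd s f y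
      = ∑ s, (∑ m, christoffel g s c m y * christoffel g m a b y) * pd s f y := by
    intro a b c
    simp only [Finset.mul_sum, Finset.sum_mul]
    rw [Finset.sum_comm]
    refine Finset.sum_congr rfl fun s _ => Finset.sum_congr rfl fun m _ => ?_
    rw [hg.christoffel_symm s m c]
    ring
  have e1 : ∀ s, christoffel g s i j = christoffel g s j i :=
    fun s => funext fun z => hg.christoffel_symm s i j z
  have e2 : ∀ s, christoffel g s i k = christoffel g s k i :=
    fun s => funext fun z => hg.christoffel_symm s i k z
  have e3 : ∀ s, christoffel g s k j y = christoffel g s j k y :=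
    fun s => hg.christoffel_symm s k j y
  have e4 : ∀ m a, pd m (pd a f) y = pd a (pd m f) y := fun m a => pd_comm hU hf hy m a
  simp only [covDeriv, hd, h3, hess, curvOp, mul_sub, Finset.sum_sub_distrib, hq, e1, e2, e3,
    sub_mul, add_mul, Finset.sum_add_distrib]
  have e5 : ∀ a b : Fin n, ∑ s, christoffel g s a i y * pd s (pd b f) y
      = ∑ s, christoffel g s a i y * pd b (pd s f) y :=
    fun a b => Finset.sum_congr rfl fun s _ => by rw [e4]
  rw [e5, e5]
  ring

/-- The gradient vector `F^l = g^{la} ∂ₐ f`. -/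
def grad (g : RSpace n → Matrix (Fin n) (Fin n) ℝ) (f : RSpace n → ℝ) (y : RSpace n)
    (l : Fin n) : ℝ :=
  ∑ a, (g y)⁻¹ l a * pd a f y

theorem IsMetricOn.sum_mul_grad (hg : IsMetricOn U g) (hy : y ∈ U) (i : Fin n) :
    ∑ l, g y i l * grad g f y l = pd i f y :=
  hg.sum_mul_inv_mul hy (fun a => pd a f y) i

theorem IsMetricOn.sum_riem_mul_grad (hg : IsMetricOn U g) (hy : y ∈ U) (i j k : Fin n) :
    ∑ l, riem g k j i l y * grad g f y l = -∑ l, curvOp g l k j i y * pd l f y := by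
  have h : ∀ a, ∑ l, (g y)⁻¹ a l * riem g k j l i y = curvOp g a k j i y :=
    fun a => hg.sum_inv_mul_mul hy (fun m => curvOp g m k j i y) a
  simp only [hg.riem_skew hy k j i, neg_mul, Finset.sum_neg_distrib, ← h, grad, Finset.mul_sum,
    Finset.sum_mul]
  rw [Finset.sum_comm]
  congr 1
  refine Finset.sum_congr rfl fun a _ => Finset.sum_congr rfl fun l _ => ?_
  rw [hg.inv_symm y l a]
  ring

theorem IsMetricOn.pd_gradSq (hg : IsMetricOn U g) (hf : ContDiffOn ℝ ∞ f U) (hy : y ∈ U)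
    (m : Fin n) : pd m (gradSq g f) y = 2 * ∑ l, hess g f m l y * grad g f y l := by
  have hf1 := contDiffOn_pd hg.isOpen hf
  have d1 := fun a => differentiableAt_of_mem hg.isOpen (hf1 a) hy
  have h0 : gradSq g f = fun z => ∑ j, ∑ k, (g z)⁻¹ j k * (pd j f z * pd k f z) := by
    funext z
    simp only [gradSq, normSq₁, mul_assoc]
  rw [h0, hg.pd_contract hy (T := fun j k z => pd j f z * pd k f z)
    (fun j k => (hf1 j).mul (hf1 k))]
  have hc : ∀ j k, covDeriv g (fun j k z => pd j f z * pd k f z) m j k y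
      = hess g f m j y * pd k f y + pd j f y * hess g f m k y := by
    intro j k
    have c1 : ∑ s, christoffel g s m j y * (pd s f y * pd k f y)
        = (∑ s, christoffel g s m j y * pd s f y) * pd k f y := by
      simp only [Finset.sum_mul, mul_assoc]
    have c2 : ∑ s, christoffel g s m k y * (pd j f y * pd s f y)
        = pd j f y * ∑ s, christoffel g s m k y * pd s f y := by
      simp only [Finset.mul_sum, mul_left_comm]
    simp only [covDeriv, hess, pd_mul (d1 j) (d1 k), c1, c2]
    ring
  have s1 : ∑ j, ∑ k, (g y)⁻¹ j k * (hess g f m j y * pd k f y)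
      = ∑ l, hess g f m l y * grad g f y l := by
    simp only [grad, Finset.mul_sum, mul_left_comm]
  have s2 : ∑ j, ∑ k, (g y)⁻¹ j k * (pd j f y * hess g f m k y)
      = ∑ l, hess g f m l y * grad g f y l := by
    rw [← s1, Finset.sum_comm]
    refine Finset.sum_congr rfl fun a _ => Finset.sum_congr rfl fun l _ => ?_
    rw [hg.inv_symm y l a]
    ring
  simp only [hc, mul_add, Finset.sum_add_distrib, s1, s2]
  ring

/-- Symmetry is inherited from the Hessian through the soliton equation. -/
theorem IsMetricOn.ricci_symm_of_soliton (hg : IsMetricOn U g) (hf : ContDiffOn ℝ ∞ f U)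
    (hS : ∀ z ∈ U, ∀ i j, ricci g i j z = hess g f i j z) (hy : y ∈ U) (i j : Fin n) :
    ricci g i j y = ricci g j i y := by
  rw [hS y hy, hS y hy, hg.hess_symm hf hy]

/-- On a steady soliton, `∇ₖ R_{ij} - ∇ⱼ R_{ik} = R_{kjil} ∇^l f`. -/
theorem IsMetricOn.covDeriv_ricci_sub (hg : IsMetricOn U g) (hf : ContDiffOn ℝ ∞ f U)
    (hS : ∀ z ∈ U, ∀ i j, ricci g i j z = hess g f i j z) (hy : y ∈ U) (k i j : Fin n) :
    covDeriv g (ricci g) k i j y - covDeriv g (ricci g) j i k y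
      = ∑ l, riem g k j i l y * grad g f y l := by
  rw [covDeriv_congr hg.isOpen hS hy, covDeriv_congr hg.isOpen hS hy,
    hg.covDeriv_hess_sub hf hy, hg.sum_riem_mul_grad hy]

/-- On a steady soliton, `R + |∇f|²` is constant. -/
theorem IsMetricOn.pd_scal_of_soliton (hg : IsMetricOn U g) (hf : ContDiffOn ℝ ∞ f U)
    (hS : ∀ z ∈ U, ∀ i j, ricci g i j z = hess g f i j z) (hy : y ∈ U) (j : Fin n) :
    pd j (scal g) y = -pd j (gradSq g f) y := by
  have hsym : ∀ z ∈ U, ∀ a b, ricci g a b z = ricci g b a z :=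
    fun z hz => hg.ricci_symm_of_soliton hf hS hz
  -- Trace of the commutator identity. By `h2` and `h3` the left side is `½∇R - ∇R`; by `h4` the
  -- right side is `Ric(∇f) = ½∇G`.
  have h1 : ∑ k, ∑ i, (g y)⁻¹ k i *
      (covDeriv g (ricci g) k i j y - covDeriv g (ricci g) j i k y)
      = ∑ l, ricci g j l y * grad g f y l := by
    simp only [hg.covDeriv_ricci_sub hf hS hy, ricci, Finset.mul_sum, Finset.sum_mul]
    have e : ∀ k i l, (g y)⁻¹ k i * (riem g k j i l y * grad g f y l)
        = (g y)⁻¹ k i * riem g j k l i y * grad g f y l := fun k i l => by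
      rw [riem_swap, hg.riem_skew hy, neg_neg, mul_assoc]
    simp only [e]
    symm
    rw [Finset.sum_comm]
    exact Finset.sum_congr rfl fun _ _ => Finset.sum_comm
  have h2 : ∑ k, ∑ i, (g y)⁻¹ k i * covDeriv g (ricci g) j i k y = pd j (scal g) y := by
    rw [hg.pd_scal hy]
    refine Finset.sum_congr rfl fun a _ => Finset.sum_congr rfl fun b _ => ?_
    rw [covDeriv_symm hg.isOpen hsym hy j b a]
  have h3 : 2 * ∑ k, ∑ i, (g y)⁻¹ k i * covDeriv g (ricci g) k i j y = pd j (scal g) y := by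
    rw [← hg.contracted_bianchi hy j]
    congr 1
    refine Finset.sum_congr rfl fun a _ => Finset.sum_congr rfl fun b _ => ?_
    rw [covDeriv_symm hg.isOpen hsym hy a]
  have h4 := hg.pd_gradSq hf hy j
  simp only [← hS y hy] at h4
  simp only [mul_sub, Finset.sum_sub_distrib, h2] at h1
  linarith

/-- The Cotton tensor of a steady soliton with vanishing Weyl tensor. -/
theorem IsMetricOn.cotton_eq (hn : 3 ≤ n) (hg : IsMetricOn U g) (hf : ContDiffOn ℝ ∞ f U)
    (hS : ∀ z ∈ U, ∀ i j, ricci g i j z = hess g f i j z)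
    (hy : y ∈ U) (hW : ∀ i j k l, weyl g i j k l y = 0) (i j k : Fin n) :
    cotton g i j k y = 1 / ((n : ℝ) - 2) *
      ((ricci g i k y * pd j f y - ricci g i j y * pd k f y)
        - 1 / ((n : ℝ) - 1) *
          (g y i k * (scal g y * pd j f y - 1 / 2 * pd j (gradSq g f) y)
            - g y i j * (scal g y * pd k f y - 1 / 2 * pd k (gradSq g f) y))) := by
  have hn' : (3 : ℝ) ≤ n := by exact_mod_cast hn
  have n1 : (n : ℝ) - 1 ≠ 0 := by linarith
  have n2 : (n : ℝ) - 2 ≠ 0 := by linarith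
  have hsym := hg.ricci_symm_of_soliton hf hS hy
  have hG : ∀ a, ∑ l, ricci g a l y * grad g f y l = 1 / 2 * pd a (gradSq g f) y := by
    intro a
    rw [hg.pd_gradSq hf hy]
    simp only [hS y hy]
    ring
  have hF := fun a => hg.sum_mul_grad (f := f) hy a
  have hR : ∀ l, riem g k j i l y = 1 / ((n : ℝ) - 2) * (g y k i * ricci g j l y
      - g y k l * ricci g j i y - g y j i * ricci g k l y + g y j l * ricci g k i y)
      - scal g y / (((n : ℝ) - 1) * ((n : ℝ) - 2)) * (g y k i * g y j l - g y k l * g y j i) := by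
    intro l
    have := hW k j i l
    simp only [weyl] at this
    linarith
  -- Contracting with `∇f` turns each `g` carrying `l` into `df` and each `Ric` carrying `l` into
  -- `½∇G`.
  have hsum : ∑ l, riem g k j i l y * grad g f y l
      = 1 / ((n : ℝ) - 2) * (g y k i * (1 / 2 * pd j (gradSq g f) y)
        - pd k f y * ricci g j i y - g y j i * (1 / 2 * pd k (gradSq g f) y)
        + pd j f y * ricci g k i y)
      - scal g y / (((n : ℝ) - 1) * ((n : ℝ) - 2))
        * (g y k i * pd j f y - pd k f y * g y j i) := by
    rw [← hG, ← hG, ← hF, ← hF]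
    simp only [hR, Finset.mul_sum, Finset.sum_mul, ← Finset.sum_add_distrib,
      ← Finset.sum_sub_distrib]
    exact Finset.sum_congr rfl fun l _ => by ring
  -- With `∇R = -∇G`, the `∇G` coefficients combine as `½/(n-2) - ½/(n-1) = ½/((n-1)(n-2))`.
  rw [cotton, hg.covDeriv_ricci_sub hf hS hy, hsum, hg.pd_scal_of_soliton hf hS hy,
    hg.pd_scal_of_soliton hf hS hy, hg.symm y k i, hg.symm y j i, hsym j i, hsym k i]
  field_simp
  ring

end Soliton

/-! ### Norms of 3-tensors -/

section Norm

variable {n : ℕ} {U : Set (RSpace n)} {g : RSpace n → Matrix (Fin n) (Fin n) ℝ} {y : RSpace n}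

theorem normSq₃_const_mul (c : ℝ) (T : Fin n → Fin n → Fin n → ℝ) :
    normSq₃ g (fun i j k => c * T i j k) y = c ^ 2 * normSq₃ g T y := by
  simp only [normSq₃, Finset.mul_sum]
  repeat refine Finset.sum_congr rfl fun _ _ => ?_
  ring

/-- The inner product of covariant 3-tensors. -/
def inner₃ (g : RSpace n → Matrix (Fin n) (Fin n) ℝ) (S T : Fin n → Fin n → Fin n → ℝ)
    (y : RSpace n) : ℝ :=
  ∑ i, ∑ j, ∑ k, ∑ a, ∑ b, ∑ c,
    (g y)⁻¹ i a * (g y)⁻¹ j b * (g y)⁻¹ k c * S i j k * T a b c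

theorem inner₃_comm (hg : IsMetricOn U g) (S T : Fin n → Fin n → Fin n → ℝ) :
    inner₃ g S T y = inner₃ g T S y := by
  have h : ∀ S T : Fin n → Fin n → Fin n → ℝ, inner₃ g S T y
      = ∑ p : Fin n × Fin n × Fin n, ∑ q : Fin n × Fin n × Fin n,
        (g y)⁻¹ p.1 q.1 * (g y)⁻¹ p.2.1 q.2.1 * (g y)⁻¹ p.2.2 q.2.2
          * S p.1 p.2.1 p.2.2 * T q.1 q.2.1 q.2.2 := fun S T => by
    simp only [inner₃, Fintype.sum_prod_type]
  rw [h, h, Finset.sum_comm]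
  refine Finset.sum_congr rfl fun p _ => Finset.sum_congr rfl fun q _ => ?_
  rw [hg.inv_symm y q.1, hg.inv_symm y q.2.1, hg.inv_symm y q.2.2]
  ring

theorem normSq₃_add_const_mul (hg : IsMetricOn U g) (c : ℝ) (S K : Fin n → Fin n → Fin n → ℝ) :
    normSq₃ g (fun i j k => S i j k + c * K i j k) y
      = normSq₃ g S y + 2 * c * inner₃ g S K y + c ^ 2 * inner₃ g K K y := by
  have h : normSq₃ g (fun i j k => S i j k + c * K i j k) y
      = normSq₃ g S y + c * inner₃ g S K y + c * inner₃ g K S y + c ^ 2 * inner₃ g K K y := by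
    simp only [normSq₃, inner₃, Finset.mul_sum, ← Finset.sum_add_distrib]
    repeat refine Finset.sum_congr rfl fun _ _ => ?_
    ring
  rw [h, inner₃_comm hg K S]
  ring

/-- The inner product of a 3-tensor that is skew in its last two indices with
`g_{ik} V_j - g_{ij} V_k`. -/
theorem IsMetricOn.inner₃_skew (hg : IsMetricOn U g) (hy : y ∈ U)
    {S : Fin n → Fin n → Fin n → ℝ} (hS : ∀ i j k, S i j k = -S i k j) (V : Fin n → ℝ) :
    inner₃ g S (fun i j k => g y i k * V j - g y i j * V k) y
      = 2 * ∑ j, (∑ i, ∑ k, (g y)⁻¹ i k * S i j k) * ∑ b, (g y)⁻¹ j b * V b := by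
  let W : Fin n → ℝ := fun j => ∑ b, (g y)⁻¹ j b * V b
  have hδ : ∀ i k, ∑ a, (g y)⁻¹ i a * ∑ c, g y a c * (g y)⁻¹ k c = (g y)⁻¹ k i :=
    fun i k => hg.sum_inv_mul_mul hy (fun c => (g y)⁻¹ k c) i
  have h1 : ∀ i j k, ∑ a, ∑ b, ∑ c, (g y)⁻¹ i a * (g y)⁻¹ j b * (g y)⁻¹ k c
      * (g y a c * V b) = (g y)⁻¹ i k * W j := by
    intro i j k
    rw [hg.inv_symm y i k, ← hδ i k]
    rw [Finset.sum_mul]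
    refine Finset.sum_congr rfl fun a _ => ?_
    rw [Finset.mul_sum]
    refine Finset.sum_congr rfl fun b _ => ?_
    rw [Finset.mul_sum, Finset.sum_mul]
    exact Finset.sum_congr rfl fun c _ => by ring
  have h2 : ∀ i j k, ∑ a, ∑ b, ∑ c, (g y)⁻¹ i a * (g y)⁻¹ j b * (g y)⁻¹ k c
      * (g y a b * V c) = (g y)⁻¹ i j * W k := by
    intro i j k
    rw [← h1 i k j]
    refine Finset.sum_congr rfl fun a _ => ?_
    rw [Finset.sum_comm]
    refine Finset.sum_congr rfl fun b _ => Finset.sum_congr rfl fun c _ => ?_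
    ring
  have h3 : inner₃ g S (fun i j k => g y i k * V j - g y i j * V k) y
      = ∑ i, ∑ j, ∑ k, S i j k * ((g y)⁻¹ i k * W j - (g y)⁻¹ i j * W k) := by
    refine Finset.sum_congr rfl fun i _ => Finset.sum_congr rfl fun j _ =>
      Finset.sum_congr rfl fun k _ => ?_
    rw [← h1 i j k, ← h2 i j k]
    simp only [← Finset.sum_sub_distrib, Finset.mul_sum]
    repeat refine Finset.sum_congr rfl fun _ _ => ?_
    ring
  have h4 : ∑ i, ∑ j, ∑ k, S i j k * ((g y)⁻¹ i k * W j)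
      = ∑ j, (∑ i, ∑ k, (g y)⁻¹ i k * S i j k) * W j := by
    rw [Finset.sum_comm]
    simp only [Finset.sum_mul]
    repeat refine Finset.sum_congr rfl fun _ _ => ?_
    ring
  -- Exchanging `j` and `k` and using skewness shows that both halves contribute equally, whence the
  -- factor 2.
  have h5 : ∑ i, ∑ j, ∑ k, S i j k * ((g y)⁻¹ i j * W k)
      = -∑ i, ∑ j, ∑ k, S i j k * ((g y)⁻¹ i k * W j) := by
    simp only [← Finset.sum_neg_distrib]
    refine Finset.sum_congr rfl fun i _ => ?_
    rw [Finset.sum_comm]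
    refine Finset.sum_congr rfl fun j _ => Finset.sum_congr rfl fun k _ => ?_
    rw [hS i k j]
    ring
  rw [h3]
  simp only [mul_sub, Finset.sum_sub_distrib, h5, h4]
  ring

/-- The norm of the trace-free part of a 3-tensor that is skew in its last two indices. -/
theorem IsMetricOn.normSq₃_traceFree (hn : 3 ≤ n) (hg : IsMetricOn U g) (hy : y ∈ U)
    {T : Fin n → Fin n → Fin n → ℝ} (hT : ∀ i j k, T i j k = -T i k j) {V : Fin n → ℝ}
    (hV : ∀ j, ∑ i, ∑ k, (g y)⁻¹ i k * T i j k = V j) :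
    normSq₃ g (fun i j k => T i j k - 1 / ((n : ℝ) - 1) * (g y i k * V j - g y i j * V k)) y
      = normSq₃ g T y - 2 / ((n : ℝ) - 1) * normSq₁ g V y := by
  have hn' : (3 : ℝ) ≤ n := by exact_mod_cast hn
  have n1 : (n : ℝ) - 1 ≠ 0 := by linarith
  let K : Fin n → Fin n → Fin n → ℝ := fun i j k => g y i k * V j - g y i j * V k
  have hKs : ∀ i j k, K i j k = -K i k j := fun i j k => by simp only [K]; ring
  -- The `n` is `g^{ik}g_{ik}`, and the other term removes one `V`. So `T - K/(n-1)` is trace-free,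
  -- and expanding its square with `⟨T,K⟩ = 2|V|²` and `|K|² = 2(n-1)|V|²` gives `-4/(n-1) +
  -- 2/(n-1)` as the coefficient of `|V|²`.
  have hK : ∀ j, ∑ i, ∑ k, (g y)⁻¹ i k * K i j k = ((n : ℝ) - 1) * V j := by
    intro j
    have t1 : ∑ i, ∑ k, (g y)⁻¹ i k * (g y i k * V j) = n * V j := by
      have : ∀ i, ∑ k, (g y)⁻¹ i k * (g y i k * V j) = V j := fun i => by
        have h := congrFun (congrFun (hg.inv_mul hy) i) i
        rw [Matrix.mul_apply, Matrix.one_apply_eq] at h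
        simp only [← mul_assoc, ← Finset.sum_mul]
        rw [Finset.sum_congr rfl fun k _ => by rw [hg.symm y i k], h, one_mul]
      simp [this]
    have t2 : ∑ i, ∑ k, (g y)⁻¹ i k * (g y i j * V k) = V j := by
      rw [← hg.sum_mul_inv_mul hy V j]
      simp only [Finset.mul_sum, hg.symm y _ j, mul_left_comm]
    simp only [K, mul_sub, Finset.sum_sub_distrib, t1, t2]
    ring
  have hN : ∑ j, V j * ∑ b, (g y)⁻¹ j b * V b = normSq₁ g V y := by
    simp only [normSq₁, Finset.mul_sum]
    exact Finset.sum_congr rfl fun _ _ => Finset.sum_congr rfl fun _ _ => by ring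
  have b1 : inner₃ g T K y = 2 * normSq₁ g V y := by
    rw [hg.inner₃_skew hy hT]
    simp only [hV, hN]
  have b2 : inner₃ g K K y = 2 * (((n : ℝ) - 1) * normSq₁ g V y) := by
    rw [hg.inner₃_skew hy hKs]
    simp only [hK, ← hN, Finset.mul_sum, mul_assoc]
  have h := normSq₃_add_const_mul (y := y) hg (-(1 / ((n : ℝ) - 1))) T K
  rw [b1, b2] at h
  simp only [neg_mul, ← sub_eq_add_neg] at h
  rw [h]
  field_simp
  ring

end Norm

/-- The norm of the Cotton tensor of a steady soliton with vanishing Weyl tensor, in a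
coordinate domain. -/
theorem IsMetricOn.normSq₃_cotton {n : ℕ} (hn : 3 ≤ n) {U : Set (RSpace n)}
    {g : RSpace n → Matrix (Fin n) (Fin n) ℝ} {f : RSpace n → ℝ} {y : RSpace n}
    (hg : IsMetricOn U g) (hf : ContDiffOn ℝ ∞ f U)
    (hS : ∀ z ∈ U, ∀ i j, ricci g i j z = hess g f i j z)
    (hy : y ∈ U) (hW : ∀ i j k l, weyl g i j k l y = 0) :
    normSq₃ g (fun i j k => cotton g i j k y) y
      = 1 / ((n : ℝ) - 2) ^ 2 *
        (normSq₃ g (fun i j k => ricci g i k y * pd j f y - ricci g i j y * pd k f y) y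
          - 2 / ((n : ℝ) - 1) *
            normSq₁ g (fun i => scal g y * pd i f y - 1 / 2 * pd i (gradSq g f) y) y) := by
  have hsym := hg.ricci_symm_of_soliton hf hS hy
  simp only [hg.cotton_eq hn hf hS hy hW]
  rw [normSq₃_const_mul, one_div_pow]
  congr 1
  refine hg.normSq₃_traceFree hn hy
    (T := fun i j k => ricci g i k y * pd j f y - ricci g i j y * pd k f y)
    (V := fun i => scal g y * pd i f y - 1 / 2 * pd i (gradSq g f) y)
    (fun i j k => by ring) fun j => ?_
  -- The trace of `T` is `R∇f - Ric(∇f)`, and `Ric(∇f) = ½∇G` by the soliton equation.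
  have t1 : ∑ i, ∑ k, (g y)⁻¹ i k * (ricci g i k y * pd j f y) = scal g y * pd j f y := by
    simp only [scal, Finset.sum_mul, mul_assoc]
  have t2 : ∑ i, ∑ k, (g y)⁻¹ i k * (ricci g i j y * pd k f y)
      = 1 / 2 * pd j (gradSq g f) y := by
    rw [hg.pd_gradSq hf hy]
    simp only [← hS y hy, grad, Finset.mul_sum]
    refine Finset.sum_congr rfl fun i _ => Finset.sum_congr rfl fun k _ => ?_
    rw [hsym i j]
    ring
  simp only [mul_sub, Finset.sum_sub_distrib, t1, t2]

end LocalTensor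

/-- In every chart `e` of the smooth structure and at every point `p` of its domain; `gₑ` and `f`
are the metric and the potential function in the coordinates of `e`, and `y` are the coordinates
of `p`. -/
theorem lemma3p1 {n : ℕ} (hn : 3 ≤ n) {M : Type*} [TopologicalSpace M]
    [ChartedSpace (RSpace n) M] [IsManifold (𝓡 n) ∞ M] (g : SmoothMetric n M) (F : M → ℝ)
    (hF : IsGradientSteadySoliton g F) (hW : HasVanishingWeyl g)
    (e : OpenPartialHomeomorph M (RSpace n)) (he : e ∈ IsManifold.maximalAtlas (𝓡 n) ∞ M)
    (p : M) (hp : p ∈ e.source) :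
    let gₑ := metricCoord g e
    let f : RSpace n → ℝ := F ∘ e.symm
    let y : RSpace n := e p
    LocalTensor.normSq₃ gₑ (fun i j k => LocalTensor.cotton gₑ i j k y) y
      = 1 / ((n : ℝ) - 2) ^ 2 *
        (LocalTensor.normSq₃ gₑ (fun i j k =>
            LocalTensor.ricci gₑ i k y * LocalTensor.pd j f y
              - LocalTensor.ricci gₑ i j y * LocalTensor.pd k f y) y
          - 2 / ((n : ℝ) - 1) *
            LocalTensor.normSq₁ gₑ (fun i =>
              LocalTensor.scal gₑ y * LocalTensor.pd i f y
                - 1 / 2 * LocalTensor.pd i (LocalTensor.gradSq gₑ f) y) y) := by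
  intro gₑ f y
  have hf : ContDiffOn ℝ ∞ f e.target := contMDiffOn_iff_contDiffOn.1
    (hF.smooth.comp_contMDiffOn (contMDiffOn_symm_of_mem_maximalAtlas he))
  refine (isMetricOn_metricCoord g he).normSq₃_cotton hn hf (fun z hz i j => ?_)
    (e.map_source hp) (hW e he p hp)
  -- The soliton equation gets differentiated, so it is needed on the whole chart target, not only
  -- at `e p`.
  have h := hF.ricci_eq_hess e he (e.symm z) (e.map_target hz) i j
  rwa [e.right_inv hz] at h

end
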